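/- Let $a,b,c,d,e$ be nonzero integers and put $$f(x)=\frac{(x+a)(x+b)(x+c)}{x},\qquad g(y)=\frac{(y+d)(y+e)\left(y+\frac{cd}{a}\right)}{y^{2}}.$$ Then each of the two equations $$z^2=f(x)^2+g(y)^2\qquad\text{and}\qquad z^2=f(x)^2-g(y)^2$$ has infinitely many nontrivial rational solutions. Here a rational solution is a triple $(x,y,z)\in\mathbb{Q}^3$ with $x\neq 0$ and $y\neq 0$ that satisfies the equation, and it is called nontrivial if $f(x)g(y)\neq 0$ and $f(x)^2\neq g(y)^2$. -/

import Mathlib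

/-- The Laurent polynomial `f = (x + a)(x + b)(x + c) / x`, as a function of `x ≠ 0`. -/
def laurentF (a b c : ℤ) (x : ℚ) : ℚ :=
  (x + a) * (x + b) * (x + c) / x

/-- The Laurent polynomial `g = (y + d)(y + e)(y + cd/a) / y²`, as a function of `y ≠ 0`
(the quotient `cd/a` is taken in `ℚ`). -/
def laurentG (a c d e : ℤ) (y : ℚ) : ℚ :=
  (y + d) * (y + e) * (y + (c : ℚ) * d / a) / y ^ 2

/-- The nontrivial rational solutions of `z² = f(x)² + g(y)²`, for Laurent polynomials `f`, `g`
given by their values at nonzero arguments. A solution `(x, y, z)` is `p = (p.1, p.2.1, p.2.2)`. -/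
def nontrivialSolutionsPlus (f g : ℚ → ℚ) : Set (ℚ × ℚ × ℚ) :=
  {p | p.1 ≠ 0 ∧ p.2.1 ≠ 0 ∧ p.2.2 ^ 2 = f p.1 ^ 2 + g p.2.1 ^ 2 ∧
    f p.1 * g p.2.1 ≠ 0 ∧ f p.1 ^ 2 ≠ g p.2.1 ^ 2}

/-- The nontrivial rational solutions of `z² = f(x)² - g(y)²`, for Laurent polynomials `f`, `g`
given by their values at nonzero arguments. A solution `(x, y, z)` is `p = (p.1, p.2.1, p.2.2)`. -/
def nontrivialSolutionsMinus (f g : ℚ → ℚ) : Set (ℚ × ℚ × ℚ) :=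
  {p | p.1 ≠ 0 ∧ p.2.1 ≠ 0 ∧ p.2.2 ^ 2 = f p.1 ^ 2 - g p.2.1 ^ 2 ∧
    f p.1 * g p.2.1 ≠ 0 ∧ f p.1 ^ 2 ≠ g p.2.1 ^ 2}

/-! With `y = cd/x`, the values `f(x)` and `g(y)` share the factor `(x + a)(x + c)/x`, and what
remains is the conic `w² = (x + b)² ± ((ex + cd)/(ac))²`. If `cd ≠ eb`, Pythagorean parametrisation
gives infinitely many points on it.

If `cd = eb`, the conic degenerates, but then `g(cd/u) = q f(u)` with `q = d/(ab)`, so `x` and `u`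
may vary together. On the rational curves `xu = ac` and `x + u + a + b = 0` the equation becomes a
quartic `w² = X²(X + 1)² + ε q²(X + α)²`, with `α = ac/b²` or `α = c²/(a + b - c)²`. Its points come
from a cubic `Y² = S(S² + MS + N)` on which one rational point is visible. For a suitable prime `p`
the double of that point has `p` in its denominator, so it lies in the formal group, where
multiplication by `p` goes strictly deeper (`exists_padicNorm_abscissa_gt`); hence there are
infinitely many points.

It remains to choose `p` and the curve, up to cyclic rotation of `a, b, c`. For `ε = 1`, or when `q`
has a prime in its denominator, the hyperbola works; for `ε = -1` and integral `q`, the line does,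
apart from `a = b = c`. -/

/-! ### Points on `Y² = S (S² + M S + N)` from a `p`-adically large one -/

/-- The abscissae of the affine rational points of `Y² = S (S² + M S + N)`. -/
def abscissae (M N : ℚ) : Set ℚ := {S | ∃ Y : ℚ, Y ^ 2 = S * (S ^ 2 + M * S + N)}

theorem padicNorm_add_le {p : ℕ} [Fact p.Prime] {x y t : ℚ} (hx : padicNorm p x ≤ t)
    (hy : padicNorm p y ≤ t) : padicNorm p (x + y) ≤ t :=
  padicNorm.nonarchimedean.trans (max_le hx hy)

theorem padicNorm_mul_le {p : ℕ} [Fact p.Prime] {x y s t : ℚ} (hx : padicNorm p x ≤ s)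
    (hy : padicNorm p y ≤ t) : padicNorm p (x * y) ≤ s * t := by
  rw [padicNorm.mul]
  exact mul_le_mul hx hy (padicNorm.nonneg _) ((padicNorm.nonneg _).trans hx)

theorem padicNorm_add_eq_left {p : ℕ} [Fact p.Prime] {x y : ℚ}
    (h : padicNorm p y < padicNorm p x) : padicNorm p (x + y) = padicNorm p x := by
  rw [padicNorm.add_eq_max_of_ne h.ne', max_eq_left h.le]

theorem padicNorm_one_add {p : ℕ} [Fact p.Prime] {y : ℚ} (h : padicNorm p y < 1) :
    padicNorm p (1 + y) = 1 := by
  rw [padicNorm_add_eq_left (by simpa using h)]; simp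

theorem padicNorm_pow {p : ℕ} [Fact p.Prime] (x : ℚ) (n : ℕ) :
    padicNorm p (x ^ n) = padicNorm p x ^ n := by
  induction n with
  | zero => simp
  | succ k ih => rw [pow_succ, padicNorm.mul, ih, pow_succ]

theorem padicNorm_le_inv_of_lt_one {p : ℕ} [hp : Fact p.Prime] {x : ℚ}
    (h : padicNorm p x < 1) : padicNorm p x ≤ (p : ℚ)⁻¹ := by
  have hp1 : (1 : ℚ) < p := by exact_mod_cast hp.out.one_lt
  rcases eq_or_ne x 0 with rfl | hx
  · simp
  · rw [padicNorm.eq_zpow_of_nonzero hx] at h ⊢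
    rw [← zpow_neg_one]
    rw [← zpow_zero (p : ℚ)] at h
    have := (zpow_lt_zpow_iff_right₀ hp1).1 h
    exact (zpow_le_zpow_iff_right₀ hp1).2 (by omega)

/-- The curve `Y² = S (S² + M S + N)` in the coordinates `z = S / Y`, `w = 1 / Y`. -/
def OnFormal (M N z w : ℚ) : Prop := w = z ^ 3 + M * z ^ 2 * w + N * z * w ^ 2

theorem OnFormal.norm_eq {p : ℕ} [Fact p.Prime] {M N z w : ℚ} (hM : padicNorm p M ≤ 1)
    (hN : padicNorm p N ≤ 1) (h : OnFormal M N z w) (hz : padicNorm p z < 1)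
    (hw : padicNorm p w ≤ 1) : padicNorm p w = padicNorm p z ^ 3 := by
  have e : w * (1 + (-(M * z) + -(N * w)) * z) = z ^ 3 := by
    unfold OnFormal at h; linear_combination h
  have h1 : padicNorm p ((-(M * z) + -(N * w)) * z) < 1 := by
    have : padicNorm p (-(M * z) + -(N * w)) ≤ 1 := by
      apply padicNorm_add_le <;> rw [padicNorm.neg]
      · simpa using padicNorm_mul_le hM hz.le
      · simpa using padicNorm_mul_le hN hw
    exact (padicNorm_mul_le this le_rfl).trans_lt (by simpa using hz)
  rw [← padicNorm_pow, ← e, padicNorm.mul, padicNorm_one_add h1, mul_one]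

/-- On the line `w = lz + m` the curve becomes a cubic in `z` with leading coefficient `1 + v`. `g`
says that `z₁` is a root and `dd` is the divided difference at `z₁, z₂`, so Vieta gives the third
root `-(z₁ + z₂ + k)`; negation on the curve is `(z, w) ↦ (-z, -w)`. -/
theorem onFormal_neg_third {M N z₁ z₂ l m v k : ℚ} (hv : v = (M + N * l) * l)
    (ek : k * (1 + v) = M * m + 2 * N * l * m)
    (dd : (1 + v) * (z₁ ^ 2 + z₁ * z₂ + z₂ ^ 2) + (M * m + 2 * N * l * m) * (z₁ + z₂)
      + N * m ^ 2 - l = 0)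
    (g : (1 + v) * z₁ ^ 3 + (M * m + 2 * N * l * m) * z₁ ^ 2 + (N * m ^ 2 - l) * z₁ - m = 0) :
    OnFormal M N (z₁ + z₂ + k) (l * (z₁ + z₂ + k) + -m) := by
  have key : (1 + v) * (z₁ + z₂ + k) ^ 3 - (M * m + 2 * N * l * m) * (z₁ + z₂ + k) ^ 2
      + (N * m ^ 2 - l) * (z₁ + z₂ + k) + m = 0 := by
    rw [← ek] at g dd ⊢
    linear_combination -g + (z₁ + z₂ + k + z₁) * dd
  unfold OnFormal
  subst hv
  linear_combination -key

/-- The third intersection point, reflected, of the chord (or tangent) through two points. -/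
theorem OnFormal.exists_add {p : ℕ} [Fact p.Prime] {M N z₁ w₁ z₂ w₂ t : ℚ}
    (hM : padicNorm p M ≤ 1) (hN : padicNorm p N ≤ 1) (ht : t < 1)
    (h₁ : OnFormal M N z₁ w₁) (h₂ : OnFormal M N z₂ w₂)
    (hz₁ : padicNorm p z₁ ≤ t) (hz₂ : padicNorm p z₂ ≤ t)
    (hw₁ : padicNorm p w₁ ≤ t ^ 3) (hw₂ : padicNorm p w₂ ≤ t ^ 3) :
    ∃ z w, OnFormal M N z w ∧ padicNorm p z ≤ t ∧ padicNorm p w ≤ t ^ 3 ∧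
      padicNorm p (z - (z₁ + z₂)) ≤ t ^ 3 := by
  have t0 : 0 ≤ t := (padicNorm.nonneg _).trans hz₁
  have t21 : t ^ 2 < 1 := pow_lt_one₀ t0 ht two_ne_zero
  have t32 : t ^ 3 ≤ t ^ 2 := pow_le_pow_of_le_one t0 ht.le (by norm_num)
  have t31 : t ^ 3 ≤ t := by simpa using pow_le_pow_of_le_one t0 ht.le (show 1 ≤ 3 by norm_num)
  have bM {x s : ℚ} (hx : padicNorm p x ≤ s) : padicNorm p (M * x) ≤ s := by
    simpa using padicNorm_mul_le hM hx
  have bN {x s : ℚ} (hx : padicNorm p x ≤ s) : padicNorm p (N * x) ≤ s := by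
    simpa using padicNorm_mul_le hN hx
  -- The slope `num / (1 + y)` comes from subtracting the two curve equations and cancelling `z₁ -
  -- z₂`. Its denominator is a `p`-adic unit even when `z₁ = z₂`, so chord and tangent need no
  -- separate treatment.
  set y : ℚ := -(M * (z₁ * z₁)) + -(N * (z₁ * (w₁ + w₂))) with hy
  have ny : padicNorm p y < 1 := by
    refine lt_of_le_of_lt (padicNorm_add_le ?_ ?_) t21 <;> rw [padicNorm.neg]
    · exact bM (by simpa [sq] using padicNorm_mul_le hz₁ hz₁)
    · refine bN ((padicNorm_mul_le hz₁ (padicNorm_add_le hw₁ hw₂)).trans ?_)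
      nlinarith [pow_nonneg t0 3]
  have nd : padicNorm p (1 + y) = 1 := padicNorm_one_add ny
  have d0 : 1 + y ≠ 0 := by
    intro h; rw [h] at nd; simp at nd
  set num : ℚ := z₁ * z₁ + z₁ * z₂ + z₂ * z₂ + M * (w₂ * (z₁ + z₂)) + N * (w₂ * w₂) with hnum
  have nnum : padicNorm p num ≤ t ^ 2 := by
    have hzz := padicNorm_add_le hz₁ hz₂
    refine padicNorm_add_le (padicNorm_add_le (padicNorm_add_le (padicNorm_add_le ?_ ?_) ?_)
      (bM ?_)) (bN ?_)
    · simpa [sq] using padicNorm_mul_le hz₁ hz₁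
    · simpa [sq] using padicNorm_mul_le hz₁ hz₂
    · simpa [sq] using padicNorm_mul_le hz₂ hz₂
    · exact (padicNorm_mul_le hw₂ hzz).trans (by nlinarith [pow_nonneg t0 3, pow_nonneg t0 2])
    · exact (padicNorm_mul_le hw₂ hw₂).trans (by nlinarith [pow_nonneg t0 3, pow_nonneg t0 2])
  set l : ℚ := num / (1 + y) with hl
  have nl : padicNorm p l ≤ t ^ 2 := by rw [hl, padicNorm.div, nd, div_one]; exact nnum
  have eld : l * (1 + y) = num := div_mul_cancel₀ _ d0
  set m : ℚ := w₁ + -(l * z₁) with hm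
  have nm : padicNorm p m ≤ t ^ 3 := by
    refine padicNorm_add_le hw₁ ?_
    rw [padicNorm.neg]
    exact (padicNorm_mul_le nl hz₁).trans (by ring_nf; rfl)
  have ew₁ : w₁ = l * z₁ + m := by rw [hm]; ring
  have ew₂ : w₂ = l * z₂ + m := by
    have : (1 + y) * (w₂ - (l * z₂ + m)) = 0 := by
      unfold OnFormal at h₁ h₂
      rw [hm]
      linear_combination h₂ - h₁ + (z₁ - z₂) * eld + (z₁ - z₂) * hnum + (w₂ - w₁) * hy
    rcases mul_eq_zero.1 this with h | h
    · exact absurd h d0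
    · linear_combination h
  set v : ℚ := (M + N * l) * l with hv
  have nv : padicNorm p v < 1 := by
    have h1 : padicNorm p (M + N * l) ≤ 1 := padicNorm_add_le hM (bN (nl.trans t21.le))
    exact (padicNorm_mul_le h1 nl).trans_lt (by simpa using t21)
  have nc : padicNorm p (1 + v) = 1 := padicNorm_one_add nv
  have c0 : 1 + v ≠ 0 := by
    intro h; rw [h] at nc; simp at nc
  set k : ℚ := (M * m + N * (l * m) + N * (l * m)) / (1 + v) with hk
  have nk : padicNorm p k ≤ t ^ 3 := by
    have hlm : padicNorm p (l * m) ≤ t ^ 3 :=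
      (padicNorm_mul_le nl nm).trans (by nlinarith [pow_nonneg t0 3])
    rw [hk, padicNorm.div, nc, div_one]
    exact padicNorm_add_le (padicNorm_add_le (bM nm) (bN hlm)) (bN hlm)
  have ek : k * (1 + v) = M * m + N * (l * m) + N * (l * m) := div_mul_cancel₀ _ c0
  have dd : (1 + v) * (z₁ ^ 2 + z₁ * z₂ + z₂ ^ 2) + (M * m + 2 * N * l * m) * (z₁ + z₂)
      + N * m ^ 2 - l = 0 := by
    have := eld
    rw [hnum, hy, ew₁, ew₂] at this
    rw [hv]
    linear_combination -this
  have g₁ : (1 + v) * z₁ ^ 3 + (M * m + 2 * N * l * m) * z₁ ^ 2 + (N * m ^ 2 - l) * z₁ - m = 0 := by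
    have := h₁
    unfold OnFormal at this
    rw [ew₁] at this
    rw [hv]
    linear_combination -this
  have nz : padicNorm p (z₁ + z₂ + k) ≤ t :=
    padicNorm_add_le (padicNorm_add_le hz₁ hz₂) (nk.trans t31)
  have ek' : k * (1 + v) = M * m + 2 * N * l * m := by rw [ek]; ring
  clear_value k v m l num y
  refine ⟨z₁ + z₂ + k, l * (z₁ + z₂ + k) + -m, ?_, nz, ?_, ?_⟩
  · exact onFormal_neg_third hv ek' dd g₁
  · refine padicNorm_add_le ((padicNorm_mul_le nl nz).trans (by ring_nf; rfl)) ?_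
    rwa [padicNorm.neg]
  · rwa [show z₁ + z₂ + k - (z₁ + z₂) = k by ring]

theorem OnFormal.exists_nsmul {p : ℕ} [Fact p.Prime] {M N z w t : ℚ}
    (hM : padicNorm p M ≤ 1) (hN : padicNorm p N ≤ 1) (ht : t < 1)
    (h : OnFormal M N z w) (hz : padicNorm p z ≤ t) (hw : padicNorm p w ≤ t ^ 3) (k : ℕ) :
    ∃ z' w', OnFormal M N z' w' ∧ padicNorm p z' ≤ t ∧ padicNorm p w' ≤ t ^ 3 ∧
      padicNorm p (z' - k * z) ≤ t ^ 3 := by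
  have t0 : 0 ≤ t := (padicNorm.nonneg _).trans hz
  induction k with
  | zero => exact ⟨0, 0, by simp [OnFormal], by simpa, by simpa using pow_nonneg t0 3,
      by simpa using pow_nonneg t0 3⟩
  | succ k ih =>
    obtain ⟨z₁, w₁, h₁, hz₁, hw₁, hk⟩ := ih
    obtain ⟨z₂, w₂, h₂, hz₂, hw₂, hk'⟩ := h₁.exists_add hM hN ht h hz₁ hz hw₁ hw
    refine ⟨z₂, w₂, h₂, hz₂, hw₂, ?_⟩
    have := padicNorm_add_le hk' hk
    rwa [show z₂ - (z₁ + z) + (z₁ - k * z) = z₂ - ((k + 1 : ℕ) : ℚ) * z by push_cast; ring] at this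

/-- The new point is `p` times the old one: its `z` is `p * (S / Y)` up to an error of norm at most
`t ^ 3`, hence has norm exactly `t / p`, and the abscissa `z / w` has norm `z ^ (-2)` in size. -/
theorem exists_padicNorm_abscissa_gt {p : ℕ} [hp : Fact p.Prime] {M N S : ℚ}
    (hM : padicNorm p M ≤ 1) (hN : padicNorm p N ≤ 1) (hS : S ∈ abscissae M N)
    (h : 1 < padicNorm p S) :
    ∃ S' ∈ abscissae M N, padicNorm p S < padicNorm p S' := by
  obtain ⟨Y, hY⟩ := hS
  have p0 : (0 : ℚ) < p := by exact_mod_cast hp.out.pos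
  have p1 : (1 : ℚ) < p := by exact_mod_cast hp.out.one_lt
  set a := padicNorm p S with ha
  have nY : padicNorm p Y ^ 2 = a ^ 3 := by
    have : padicNorm p (S ^ 2 + (M * S + N)) = a ^ 2 := by
      rw [← padicNorm_pow]
      apply padicNorm_add_eq_left
      rw [padicNorm_pow, ← ha]
      refine lt_of_le_of_lt (padicNorm_add_le (t := a) ?_ (hN.trans h.le)) (by nlinarith)
      simpa using padicNorm_mul_le hM ha.ge
    rw [← padicNorm_pow, hY, padicNorm.mul, add_assoc, this]; ring
  have a0 : 0 < a := one_pos.trans h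
  have S0 : S ≠ 0 := by rintro rfl; simp at ha; linarith
  have Y0 : Y ≠ 0 := by
    rintro rfl
    have := pow_pos a0 3
    rw [← nY] at this; simp at this
  have hOn : OnFormal M N (S / Y) (1 / Y) := by
    unfold OnFormal; field_simp; linear_combination hY
  have nY0 : 0 < padicNorm p Y := lt_of_le_of_ne (padicNorm.nonneg _)
    (fun e => Y0 (padicNorm.zero_of_padicNorm_eq_zero e.symm))
  set t := padicNorm p (S / Y) with ht
  have ht2 : t ^ 2 * a = 1 := by
    rw [ht, padicNorm.div, div_pow, nY, ← ha]; field_simp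
  have t0 : 0 < t := by rw [ht, padicNorm.div]; positivity
  have t1 : t < 1 := by
    by_contra! hc
    nlinarith [one_le_pow₀ hc (n := 2)]
  have nw : padicNorm p (1 / Y) ≤ 1 := by
    rw [padicNorm.div, padicNorm.one]
    refine (div_le_one nY0).2 ?_
    by_contra! hc
    have : a ^ 3 < 1 := by rw [← nY]; exact pow_lt_one₀ nY0.le hc two_ne_zero
    nlinarith [pow_pos a0 2, one_lt_pow₀ h (show 3 ≠ 0 by norm_num)]
  have nw' := hOn.norm_eq hM hN (ht ▸ t1) nw
  obtain ⟨z, w, hzw, -, hw, hd⟩ := hOn.exists_nsmul hM hN t1 le_rfl (nw'.trans (by rw [ht])).le p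
  have npz : padicNorm p (p * (S / Y)) = t / p := by
    rw [padicNorm.mul, padicNorm.padicNorm_p hp.out.one_lt, ← ht]; ring
  -- Norms are powers of `p`, so `t ≤ 1 / p` and `t ^ 2 < 1 / p`; this includes `p = 2`.
  have hlt : t ^ 3 < t / p := by
    have hti := padicNorm_le_inv_of_lt_one (p := p) (x := S / Y) t1
    rw [← ht] at hti
    have : t * p ≤ 1 := by
      calc t * p ≤ (p : ℚ)⁻¹ * p := by gcongr
        _ = 1 := inv_mul_cancel₀ p0.ne'
    rw [lt_div_iff₀ p0]
    nlinarith [mul_pos t0 t0]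
  have nz : padicNorm p z = t / p := by
    have := padicNorm_add_eq_left (p := p) (x := p * (S / Y)) (y := z - p * (S / Y))
      (by rw [npz]; exact hd.trans_lt hlt)
    rwa [add_sub_cancel, npz] at this
  have tp : t / p < t := div_lt_self t0 p1
  have tp0 : 0 < t / p := by positivity
  have nwz := hzw.norm_eq (p := p) hM hN (by rw [nz]; linarith)
    (hw.trans (pow_le_one₀ t0.le t1.le))
  have w0 : w ≠ 0 := by
    rintro rfl
    rw [nz] at nwz
    simp at nwz
    exact absurd nwz.symm (pow_ne_zero 3 (by simpa using tp0.ne'))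
  refine ⟨z / w, ⟨1 / w, ?_⟩, ?_⟩
  · unfold OnFormal at hzw
    field_simp
    linear_combination hzw
  · rw [padicNorm.div, nwz, nz]
    have : a = 1 / t ^ 2 := by field_simp; linarith
    rw [this, div_lt_div_iff₀ (by positivity) (by positivity)]
    have : (t / p) ^ 2 < t ^ 2 := pow_lt_pow_left₀ tp tp0.le two_ne_zero
    nlinarith

theorem abscissae_infinite_of_padicNorm {p : ℕ} [Fact p.Prime] {M N S : ℚ}
    (hM : padicNorm p M ≤ 1) (hN : padicNorm p N ≤ 1) (hS : S ∈ abscissae M N)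
    (h : 1 < padicNorm p S) : (abscissae M N).Infinite := by
  intro hfin
  have hne : ({S' ∈ abscissae M N | 1 < padicNorm p S'}).Nonempty := ⟨S, hS, h⟩
  obtain ⟨S₀, ⟨h₀, h₀'⟩, hmax⟩ := Set.exists_max_image _ (padicNorm p)
    (hfin.subset (Set.sep_subset _ _)) hne
  obtain ⟨S₁, h₁, hlt⟩ := exists_padicNorm_abscissa_gt hM hN h₀ h₀'
  exact absurd (hmax S₁ ⟨h₁, h₀'.trans hlt⟩) (not_le.2 hlt)

/-- This is the duplication formula. -/
theorem double_mem_abscissae {M N S Y : ℚ} (h : Y ^ 2 = S * (S ^ 2 + M * S + N)) (hY : Y ≠ 0) :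
    ((S ^ 2 - N) / (2 * Y)) ^ 2 ∈ abscissae M N := by
  refine ⟨(S ^ 2 - N) / (2 * Y) *
    ((S ^ 4 + 2 * M * S ^ 3 + 6 * N * S ^ 2 + 2 * M * N * S + N ^ 2) / (4 * Y ^ 2)), ?_⟩
  have hS : S ≠ 0 := by
    rintro rfl
    exact hY (by simpa using h)
  have e : M = (Y ^ 2 - S ^ 3 - N * S) / S ^ 2 := by field_simp; linear_combination -h
  rw [e]
  field_simp
  ring

theorem abscissae_infinite_of_scale {M N k : ℚ} (hk : k ≠ 0)
    (h : (abscissae (k ^ 2 * M) (k ^ 4 * N)).Infinite) : (abscissae M N).Infinite := by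
  refine (h.image (f := fun S => S / k ^ 2) ?_).mono ?_
  · intro x _ y _ hxy
    simpa [hk] using hxy
  · rintro _ ⟨S, ⟨Y, hY⟩, rfl⟩
    refine ⟨Y / k ^ 3, ?_⟩
    field_simp
    linear_combination hY

/-! ### Infinite order points in two families -/

theorem abscissae_infinite_of_double {p : ℕ} [Fact p.Prime] {M N S Y : ℚ}
    (hM : padicNorm p M ≤ 1) (hN : padicNorm p N ≤ 1)
    (h : Y ^ 2 = S * (S ^ 2 + M * S + N)) (hY : Y ≠ 0)
    (hd : 1 < padicNorm p ((S ^ 2 - N) / (2 * Y))) : (abscissae M N).Infinite := by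
  refine abscissae_infinite_of_padicNorm hM hN (double_mem_abscissae h hY) ?_
  rw [padicNorm_pow]
  exact one_lt_pow₀ hd two_ne_zero

theorem padicNorm_two_le {p : ℕ} [Fact p.Prime] : padicNorm p 2 ≤ 1 := by
  exact_mod_cast padicNorm.of_int (p := p) 2

theorem padicNorm_four_le {p : ℕ} [Fact p.Prime] : padicNorm p 4 ≤ 1 := by
  exact_mod_cast padicNorm.of_int (p := p) 4

theorem padicNorm_one_sub {p : ℕ} [Fact p.Prime] {y : ℚ} (h : padicNorm p y < 1) :
    padicNorm p (1 - y) = 1 := by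
  rw [sub_eq_add_neg]
  exact padicNorm_one_add (by rwa [padicNorm.neg])

theorem padicNorm_sub_le {p : ℕ} [Fact p.Prime] {x y t : ℚ} (hx : padicNorm p x ≤ t)
    (hy : padicNorm p y ≤ t) : padicNorm p (x - y) ≤ t :=
  padicNorm.sub.trans (max_le hx hy)

theorem padicNorm_sq_div_two_lt {p : ℕ} [hp : Fact p.Prime] {h : ℚ} (hh : padicNorm p h < 1) :
    padicNorm p (h ^ 2 / 2) < 1 := by
  have h0 := padicNorm.nonneg (p := p) h
  rw [padicNorm.div, padicNorm_pow]
  by_cases h2 : p ∣ 2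
  · obtain rfl := (Nat.prime_dvd_prime_iff_eq hp.out Nat.prime_two).1 h2
    have h3 : padicNorm 2 2 = (2 : ℚ)⁻¹ := by
      exact_mod_cast padicNorm.padicNorm_p (p := 2) one_lt_two
    have := padicNorm_le_inv_of_lt_one hh
    push_cast at this
    rw [h3, div_lt_one (by norm_num)]
    nlinarith
  · have h3 : padicNorm p 2 = 1 := by exact_mod_cast (padicNorm.nat_eq_one_iff (p := p) 2).2 h2
    rw [h3, div_one]
    exact pow_lt_one₀ h0 hh two_ne_zero

/-- The visible point is `(-ε, r(2α - 1))`. In its double, `1 - N` is a unit while `2r(2α - 1)` has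
norm less than 1. -/
theorem abscissae_infinite_of_integral {p : ℕ} [Fact p.Prime] {ε r α : ℚ} (hε : ε = 1 ∨ ε = -1)
    (hr : padicNorm p r ≤ 1) (hr2 : padicNorm p (2 * r) < 1) (hα : padicNorm p α ≤ 1)
    (r0 : r ≠ 0) (hα2 : α ≠ 1 / 2) :
    (abscissae (r ^ 2 + ε) (-4 * ε * r ^ 2 * α * (α - 1))).Infinite := by
  have nε : padicNorm p ε = 1 := by rcases hε with rfl | rfl <;> simp
  have hε2 : ε ^ 2 = 1 := by rcases hε with rfl | rfl <;> norm_num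
  have n0 : 2 * α - 1 ≠ 0 := fun h => hα2 (by linarith)
  have hr' : padicNorm p (r ^ 2) ≤ 1 := by
    rw [padicNorm_pow]; exact pow_le_one₀ (padicNorm.nonneg _) hr
  have nα : padicNorm p (ε * (α * (α - 1))) ≤ 1 := by
    rw [padicNorm.mul, nε, one_mul]
    simpa using padicNorm_mul_le hα (padicNorm_sub_le hα (padicNorm.one (p := p)).le)
  have nN : padicNorm p (-4 * ε * r ^ 2 * α * (α - 1)) < 1 := by
    have : -4 * ε * r ^ 2 * α * (α - 1) = -((2 * r) ^ 2 * (ε * (α * (α - 1)))) := by ring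
    rw [this, padicNorm.neg]
    refine (padicNorm_mul_le le_rfl nα).trans_lt ?_
    rw [mul_one, padicNorm_pow]
    exact pow_lt_one₀ (padicNorm.nonneg _) hr2 two_ne_zero
  refine abscissae_infinite_of_double (p := p) (S := -ε) (Y := r * (2 * α - 1))
    (padicNorm_add_le hr' nε.le) nN.le ?_ (mul_ne_zero r0 n0) ?_
  · rcases hε with rfl | rfl <;> ring
  · rw [neg_sq, hε2, padicNorm.div, padicNorm_one_sub nN]
    have h1 : padicNorm p (2 * (r * (2 * α - 1))) < 1 := by
      rw [← mul_assoc]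
      refine (padicNorm_mul_le le_rfl (t := 1) ?_).trans_lt (by simpa using hr2)
      exact padicNorm_sub_le (by simpa using padicNorm_mul_le padicNorm_two_le hα) (by simp)
    have h2 : 0 < padicNorm p (2 * (r * (2 * α - 1))) :=
      lt_of_le_of_ne (padicNorm.nonneg _) (padicNorm.nonzero (by positivity)).symm
    exact (one_lt_div h2).2 h1

/-- The visible point is `(q²h², q²h(2 - h²))`. After cancelling, its double is the square of a unit
divided by `h`. -/
theorem abscissae_infinite_of_small {p : ℕ} [Fact p.Prime] {q h : ℚ} (hq : padicNorm p q ≤ 1)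
    (hh : padicNorm p h < 1) (q0 : q ≠ 0) (h0 : h ≠ 0) :
    (abscissae ((1 - q ^ 2) * h ^ 2) (4 * q ^ 2 * (1 - h ^ 2))).Infinite := by
  have nq : padicNorm p (q ^ 2) ≤ 1 := by
    rw [padicNorm_pow]; exact pow_le_one₀ (padicNorm.nonneg _) hq
  have nh : padicNorm p (h ^ 2) ≤ 1 := by
    rw [padicNorm_pow]; exact pow_le_one₀ (padicNorm.nonneg _) hh.le
  have n1 : padicNorm p 1 ≤ 1 := (padicNorm.one (p := p)).le
  -- Halving removes the common factor 2 from `2 - h²` and from the numerator, so that `p = 2` is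
  -- covered too.
  set η := h ^ 2 / 2 with hη
  have nη : padicNorm p η < 1 := padicNorm_sq_div_two_lt hh
  have nη1 := padicNorm_one_sub nη
  have η1 : 1 - η ≠ 0 := by
    intro e; rw [e] at nη1; simp at nη1
  have e : h ^ 2 = 2 * η := by rw [hη]; ring
  refine abscissae_infinite_of_double (p := p) (S := q ^ 2 * h ^ 2)
    (Y := q ^ 2 * h * (2 - h ^ 2)) ?_ ?_ (by ring) ?_ ?_
  · simpa using padicNorm_mul_le (padicNorm_sub_le n1 nq) nh
  · simpa using padicNorm_mul_le (padicNorm_mul_le padicNorm_four_le nq) (padicNorm_sub_le n1 nh)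
  · rw [e, show 2 - 2 * η = 2 * (1 - η) by ring]
    positivity
  · have : ((q ^ 2 * h ^ 2) ^ 2 - 4 * q ^ 2 * (1 - h ^ 2)) / (2 * (q ^ 2 * h * (2 - h ^ 2)))
        = -(1 - (2 + q ^ 2 * η) * η) / (h * (1 - η)) := by
      rw [e]
      rw [show 2 - 2 * η = 2 * (1 - η) by ring]
      field_simp
      ring
    have h2 : padicNorm p ((2 + q ^ 2 * η) * η) < 1 := by
      refine (padicNorm_mul_le (s := 1) (padicNorm_add_le padicNorm_two_le ?_) le_rfl).trans_lt
        (by simpa using nη)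
      simpa using padicNorm_mul_le nq nη.le
    rw [this, padicNorm.div, padicNorm.neg, padicNorm_one_sub h2, padicNorm.mul, nη1, mul_one]
    exact (one_lt_div (lt_of_le_of_ne (padicNorm.nonneg _) (padicNorm.nonzero h0).symm)).2 hh

/-- The cubic is singular at the origin, hence rational: set `S + M = n²`. -/
theorem abscissae_zero_infinite (M : ℚ) : (abscissae M 0).Infinite := by
  have hinj : Function.Injective fun n : ℕ => (n : ℚ) ^ 2 - M := by
    intro m n h
    have : (m : ℚ) ^ 2 = (n : ℚ) ^ 2 := by simpa using h
    exact_mod_cast (pow_left_inj₀ (by positivity) (by positivity) two_ne_zero).1 this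
  refine (Set.infinite_range_of_injective hinj).mono ?_
  rintro _ ⟨n, rfl⟩
  exact ⟨n * ((n : ℚ) ^ 2 - M), by ring⟩

/-! ### The quartic `w² = X² (X + 1)² + ε q² (X + α)²` -/

theorem quadratic_zeros_finite {A B C : ℚ} (h : A ≠ 0 ∨ B ≠ 0 ∨ C ≠ 0) :
    {x : ℚ | A * x ^ 2 + B * x + C = 0}.Finite := by
  open Polynomial in
  have hP : (Polynomial.C A * X ^ 2 + Polynomial.C B * X + Polynomial.C C : ℚ[X]) ≠ 0 := by
    intro h0
    have c0 := congrArg (fun P => Polynomial.coeff P 0) h0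
    have c1 := congrArg (fun P => Polynomial.coeff P 1) h0
    have c2 := congrArg (fun P => Polynomial.coeff P 2) h0
    simp [Polynomial.coeff_X, Polynomial.coeff_C, Polynomial.coeff_X_pow] at c0 c1 c2
    tauto
  refine (Polynomial.finite_setOfPred_isRoot hP).subset fun x hx => ?_
  simpa [Polynomial.IsRoot] using hx

theorem infinite_of_infinite_pairs {P : ℚ → ℚ} (h : {p : ℚ × ℚ | p.2 ^ 2 = P p.1}.Infinite) :
    {x : ℚ | ∃ w : ℚ, w ^ 2 = P x}.Infinite := by
  intro hfin
  refine h ((hfin.biUnion (t := fun x => (fun w => (x, w)) '' {w : ℚ | w ^ 2 = P x})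
    fun x _ => Set.Finite.image _ ?_).subset ?_)
  · exact (quadratic_zeros_finite (A := 1) (B := 0) (C := -P x) (by simp)).subset
      fun w hw => by simp only [Set.mem_ofPred_eq] at hw ⊢; linarith
  · rintro ⟨x, w⟩ hw
    exact Set.mem_biUnion (show x ∈ {x : ℚ | ∃ w : ℚ, w ^ 2 = P x} from ⟨w, hw⟩) ⟨w, hw, rfl⟩

/-- The abscissae of the rational points of `w² = X² (X + 1)² + ε q² (X + α)²`. -/
def quarticAbscissae (ε q α : ℚ) : Set ℚ :=
  {X | ∃ w : ℚ, w ^ 2 = X ^ 2 * (X + 1) ^ 2 + ε * q ^ 2 * (X + α) ^ 2}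

/-- Put `w = X² + X - S/2`. The quartic terms cancel, leaving a quadratic in `X` with leading
coefficient `S + εq²` whose discriminant is the cubic in `S`. -/
theorem quarticAbscissae_infinite {ε q α : ℚ}
    (h : (abscissae (1 + ε * q ^ 2) (-4 * ε * q ^ 2 * α * (α - 1))).Infinite) :
    (quarticAbscissae ε q α).Infinite := by
  refine infinite_of_infinite_pairs
    (P := fun X => X ^ 2 * (X + 1) ^ 2 + ε * q ^ 2 * (X + α) ^ 2) ?_
  intro hfin
  refine h (((hfin.image fun p => -2 * (p.2 - p.1 ^ 2 - p.1)).union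
    (Set.finite_singleton (-(ε * q ^ 2)))).subset ?_)
  rintro S ⟨Y, hY⟩
  by_cases hS : S = -(ε * q ^ 2)
  · exact Or.inr hS
  left
  have hd : S + ε * q ^ 2 ≠ 0 := fun e => hS (by linarith)
  set X := (-(S + 2 * ε * q ^ 2 * α) - Y) / (2 * (S + ε * q ^ 2)) with hX
  have eX : X * (2 * (S + ε * q ^ 2)) = -(S + 2 * ε * q ^ 2 * α) - Y :=
    div_mul_cancel₀ _ (by positivity)
  clear_value X
  refine ⟨(X, -S / 2 + X ^ 2 + X), ?_, by ring⟩
  have hq : (S + ε * q ^ 2) * (S ^ 2 / 4 - S * (X ^ 2 + X) - ε * q ^ 2 * (X + α) ^ 2) = 0 := by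
    have e : Y = -(S + 2 * ε * q ^ 2 * α) - X * (2 * (S + ε * q ^ 2)) := by linarith
    rw [e] at hY
    linear_combination (-1 / 4) * hY
  have := (mul_eq_zero.1 hq).resolve_left hd
  simp only [Set.mem_ofPred_eq]
  linear_combination this

theorem quarticAbscissae_infinite_of_integral {p : ℕ} [Fact p.Prime] {ε q α : ℚ}
    (hε : ε = 1 ∨ ε = -1) (hq : 1 ≤ padicNorm p q) (hq2 : padicNorm p 2 < padicNorm p q)
    (hα : padicNorm p α ≤ 1) (q0 : q ≠ 0) (hα2 : α ≠ 1 / 2) :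
    (quarticAbscissae ε q α).Infinite := by
  apply quarticAbscissae_infinite
  have hpos : 0 < padicNorm p q := by linarith
  refine abscissae_infinite_of_scale (k := 1 / q) (by positivity) ?_
  have := abscissae_infinite_of_integral (p := p) (r := 1 / q) hε
    (by rw [padicNorm.div, padicNorm.one]; exact (div_le_one hpos).2 hq)
    (by rw [mul_one_div, padicNorm.div]; exact (div_lt_one hpos).2 hq2)
    hα (by positivity) hα2
  convert this using 2 <;> field_simp

theorem quarticAbscissae_one_infinite {q α : ℚ} (hα : padicNorm 2 α ≤ 1) (q0 : q ≠ 0) :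
    (quarticAbscissae 1 q α).Infinite := by
  have h2 : padicNorm 2 2 = (2 : ℚ)⁻¹ := by
    exact_mod_cast padicNorm.padicNorm_p (p := 2) one_lt_two
  have hα2 : α ≠ 1 / 2 := by
    rintro rfl
    rw [padicNorm.div, h2, padicNorm.one] at hα
    norm_num at hα
  rcases le_total 1 (padicNorm 2 q) with hq | hq
  -- For `ε = 1` the coefficient `r² + ε` has the same shape for `r = q` and, after scaling, for `r
  -- = 1/q`; one of these is 2-integral.
  · exact quarticAbscissae_infinite_of_integral (Or.inl rfl) hq (by rw [h2]; linarith) hα q0 hα2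
  · apply quarticAbscissae_infinite
    convert abscissae_infinite_of_integral (p := 2) (ε := 1) (Or.inl rfl) hq
      (by rw [padicNorm.mul, h2]; linarith) hα q0 hα2 using 2
    ring

theorem quarticAbscissae_neg_one_infinite_of_small {p : ℕ} [Fact p.Prime] {q h : ℚ}
    (hq : padicNorm p q ≤ 1) (hh : padicNorm p h < 1) (q0 : q ≠ 0) (h0 : h ≠ 0) :
    (quarticAbscissae (-1) q (1 / h ^ 2)).Infinite := by
  apply quarticAbscissae_infinite
  refine abscissae_infinite_of_scale h0 ?_
  convert abscissae_infinite_of_small hq hh q0 h0 using 2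
  · ring
  · field_simp

theorem quarticAbscissae_alpha_one_infinite (ε q : ℚ) : (quarticAbscissae ε q 1).Infinite := by
  apply quarticAbscissae_infinite
  simpa using abscissae_zero_infinite _

/-! ### The equation `z² = F(x)² + ε q² F(u)²` for a single Laurent polynomial `F` -/

/-- The Laurent polynomial `(x + a)(x + b)(x + c) / x` with rational coefficients. -/
def laurentCubic (a b c x : ℚ) : ℚ := (x + a) * (x + b) * (x + c) / x

/-- The abscissae `x` of nontrivial solutions of `z² = F(x)² + ε q² F(u)²`. -/
def twistedAbscissae (ε a b c q : ℚ) : Set ℚ :=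
  {x | ∃ u z : ℚ, x ≠ 0 ∧ u ≠ 0 ∧
    z ^ 2 = laurentCubic a b c x ^ 2 + ε * (q * laurentCubic a b c u) ^ 2 ∧
    laurentCubic a b c x * (q * laurentCubic a b c u) ≠ 0 ∧
    laurentCubic a b c x ^ 2 ≠ (q * laurentCubic a b c u) ^ 2}

theorem laurentCubic_rotate (a b c : ℚ) : laurentCubic b c a = laurentCubic a b c := by
  funext x; unfold laurentCubic; ring

theorem twistedAbscissae_rotate (ε a b c q : ℚ) :
    twistedAbscissae ε b c a q = twistedAbscissae ε a b c q := by
  unfold twistedAbscissae; rw [laurentCubic_rotate]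

theorem linear_zeros_finite {A B : ℚ} (h : A ≠ 0 ∨ B ≠ 0) : {x : ℚ | A * x + B = 0}.Finite := by
  refine (quadratic_zeros_finite (A := 0) (B := A) (C := B) (Or.inr h)).subset fun x hx => ?_
  simpa using hx

theorem twistedAbscissae_infinite_of_curve {ε a b c q α : ℚ} (q0 : q ≠ 0)
    (h : (quarticAbscissae ε q α).Infinite) {T : Set ℚ} (hT : T.Finite) (x u k : ℚ → ℚ)
    (hinj : ∀ X ∉ T, ∀ X' ∉ T, x X = x X' → X = X')
    (hcurve : ∀ X ∉ T, X ≠ 0 → x X ≠ 0 ∧ u X ≠ 0 ∧ k X ≠ 0 ∧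
      laurentCubic a b c (x X) = k X * (X * (X + 1)) ∧
      laurentCubic a b c (u X) = k X * (X + α)) :
    (twistedAbscissae ε a b c q).Infinite := by
  -- The two quadratics are the factors of `X²(X + 1)² - q²(X + α)²`; avoiding all these zeros makes
  -- the solution nontrivial.
  have hfin : (T ∪ ({X | 1 * X + 0 = 0} ∪ {X | 1 * X + 1 = 0} ∪ {X | 1 * X + α = 0} ∪
      {X | 1 * X ^ 2 + (1 - q) * X + (-q * α) = 0} ∪
      {X | 1 * X ^ 2 + (1 + q) * X + q * α = 0})).Finite :=
    hT.union <| ((((linear_zeros_finite (by simp)).union (linear_zeros_finite (by simp))).union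
      (linear_zeros_finite (by simp))).union (quadratic_zeros_finite (by simp))).union
      (quadratic_zeros_finite (by simp))
  refine ((h.sdiff hfin).image (f := x) ?_).mono ?_
  · intro X hX X' hX' e
    exact hinj X (fun hc => hX.2 (Or.inl hc)) X' (fun hc => hX'.2 (Or.inl hc)) e
  · rintro _ ⟨X, ⟨⟨w, hw⟩, hX⟩, rfl⟩
    simp only [Set.mem_union, Set.mem_ofPred_eq, not_or] at hX
    obtain ⟨hXT, ⟨⟨⟨h0, h1⟩, h2⟩, h3⟩, h4⟩ := hX
    have h0 : X ≠ 0 := by simpa using h0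
    have h1 : X + 1 ≠ 0 := by simpa using h1
    have h2 : X + α ≠ 0 := by simpa using h2
    obtain ⟨x0, u0, k0, ex, eu⟩ := hcurve X hXT h0
    refine ⟨u X, k X * w, x0, u0, ?_, ?_, ?_⟩
    · rw [ex, eu]; linear_combination (k X) ^ 2 * hw
    · rw [ex, eu]; positivity
    · rw [ex, eu]
      intro e
      have : k X ^ 2 * ((1 * X ^ 2 + (1 - q) * X + (-q * α)) *
          (1 * X ^ 2 + (1 + q) * X + q * α)) = 0 := by linear_combination e
      exact mul_ne_zero (pow_ne_zero 2 k0) (mul_ne_zero h3 h4) this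

/-- The hyperbola `x u = a c`. -/
theorem twistedAbscissae_infinite_of_hyperbola {ε a b c q : ℚ} (a0 : a ≠ 0) (b0 : b ≠ 0)
    (c0 : c ≠ 0) (q0 : q ≠ 0) (h : (quarticAbscissae ε q (a * c / b ^ 2)).Infinite) :
    (twistedAbscissae ε a b c q).Infinite := by
  refine twistedAbscissae_infinite_of_curve q0 h
    (T := {X | b * X + a = 0} ∪ {X | b * X + c = 0})
    ((linear_zeros_finite (Or.inl b0)).union (linear_zeros_finite (Or.inl b0)))
    -- `(x + a)(x + c)/x = x + a + c + ac/x` is unchanged by `x ↦ ac/x`, so the ratio of the two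
    -- values is `(x + b)/(u + b)`.
    (fun X => b * X) (fun X => a * c / (b * X))
    (fun X => (b * X + a) * (b * X + c) / X ^ 2) ?_ ?_
  · intro X _ X' _ e
    exact mul_left_cancel₀ b0 e
  · intro X hX X0
    simp only [Set.mem_union, Set.mem_ofPred_eq, not_or] at hX
    obtain ⟨h1, h2⟩ := hX
    refine ⟨by positivity, by positivity, by positivity, ?_, ?_⟩
    · unfold laurentCubic; field_simp
    · unfold laurentCubic; field_simp; ring

/-- The line `x + u + a + b = 0`. -/
theorem twistedAbscissae_infinite_of_line {ε a b c q : ℚ} (a0 : a ≠ 0) (b0 : b ≠ 0)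
    (c0 : c ≠ 0) (q0 : q ≠ 0) (hs : a + b ≠ 0) (hD : a + b - c ≠ 0)
    (h : (quarticAbscissae ε q (1 / ((a + b - c) / c) ^ 2)).Infinite) :
    (twistedAbscissae ε a b c q).Infinite := by
  obtain ⟨D, hDef⟩ : ∃ D, D = a + b - c := ⟨_, rfl⟩
  rw [← hDef] at hD h
  have hb : b = D + c - a := by rw [hDef]; ring
  have hs' : D + c ≠ 0 := by rw [hDef]; simpa using hs
  refine twistedAbscissae_infinite_of_curve q0 h
    (T := {X | D * X + -c = 0} ∪ {X | a * D * X + b * c = 0} ∪ {X | b * D * X + a * c = 0})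
    (((linear_zeros_finite (Or.inl hD)).union
      (linear_zeros_finite (Or.inl (mul_ne_zero a0 hD)))).union
      (linear_zeros_finite (Or.inl (mul_ne_zero b0 hD))))
    -- Since `u = -(a + b) - x`, the product `(x + a)(x + b)` agrees at `x` and `u`. The Möbius
    -- parameter `X` puts the remaining ratio `(x + c)u / (x(u + c))` in the form `X(X + 1)/(X +
    -- α)`.
    (fun X => c * (D + c) / (D * X + -c)) (fun X => -((D + c) * D * X) / (D * X + -c))
    (fun X => (c * (D + c) / (D * X + -c) + a) * (c * (D + c) / (D * X + -c) + b) * D /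
      ((D + c) * X)) ?_ ?_
  · intro X hX X' hX' e
    simp only [Set.mem_union, Set.mem_ofPred_eq, not_or] at hX hX'
    have h1 := hX.1.1
    have h2 := hX'.1.1
    rw [div_eq_div_iff h1 h2] at e
    have := mul_left_cancel₀ (mul_ne_zero c0 hs') e
    exact mul_left_cancel₀ hD (by linarith)
  · intro X hX X0
    simp only [Set.mem_union, Set.mem_ofPred_eq, not_or] at hX
    obtain ⟨⟨h1, h2⟩, h3⟩ := hX
    have h4 : c * (D + c) / (D * X + -c) + a ≠ 0 := by
      have : c * (D + c) / (D * X + -c) + a = (a * D * X + b * c) / (D * X + -c) := by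
        rw [hb]; field_simp; ring
      rw [this]; positivity
    have h5 : c * (D + c) / (D * X + -c) + b ≠ 0 := by
      have : c * (D + c) / (D * X + -c) + b = (b * D * X + a * c) / (D * X + -c) := by
        rw [hb]; field_simp; ring
      rw [this]; positivity
    refine ⟨by positivity, div_ne_zero (neg_ne_zero.2 (by positivity)) h1, by positivity, ?_, ?_⟩
    · unfold laurentCubic; field_simp; ring
    · unfold laurentCubic; rw [hb]; field_simp; ring

/-! ### Choice of the prime and of the rotation of `a, b, c` -/

theorem exists_integral_of_prod_eq_one (p : ℕ) [Fact p.Prime] {x y z : ℚ} (h : x * y * z = 1) :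
    (padicNorm p x ≤ 1 ∧ x ≠ 1 / 2) ∨ (padicNorm p y ≤ 1 ∧ y ≠ 1 / 2) ∨
      (padicNorm p z ≤ 1 ∧ z ≠ 1 / 2) := by
  by_contra! hc
  obtain ⟨hx, hy, hz⟩ := hc
  have half : 1 ≤ padicNorm p (1 / 2) := by
    have h2 : 0 < padicNorm p 2 :=
      lt_of_le_of_ne (padicNorm.nonneg _) (padicNorm.nonzero two_ne_zero).symm
    rw [padicNorm.div, padicNorm.one]
    exact (one_le_div h2).2 padicNorm_two_le
  -- If all three fail, each norm is at least 1, so all equal 1 and each number is `1/2`, against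
  -- the product being 1.
  have key {t : ℚ} (ht : padicNorm p t ≤ 1 → t = 1 / 2) : 1 ≤ padicNorm p t := by
    by_contra! hlt
    rw [ht hlt.le] at hlt
    linarith
  have kx := key hx
  have ky := key hy
  have kz := key hz
  have hprod : padicNorm p x * padicNorm p y * padicNorm p z = 1 := by
    rw [← padicNorm.mul, ← padicNorm.mul, h, padicNorm.one]
  have kxy : 1 ≤ padicNorm p x * padicNorm p y := one_le_mul_of_one_le_of_one_le kx ky
  have ez := hz (by nlinarith)
  have hxy : padicNorm p x * padicNorm p y ≤ 1 := by nlinarith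
  have ex := hx (by nlinarith)
  have ey := hy (by nlinarith)
  rw [ex, ey, ez] at h
  norm_num at h

theorem twistedAbscissae_infinite_of_integral (p : ℕ) [Fact p.Prime] {ε a b c q : ℚ}
    (a0 : a ≠ 0) (b0 : b ≠ 0) (c0 : c ≠ 0) (q0 : q ≠ 0)
    (H : ∀ α, padicNorm p α ≤ 1 → α ≠ 1 / 2 → (quarticAbscissae ε q α).Infinite) :
    (twistedAbscissae ε a b c q).Infinite := by
  have h : (a * c / b ^ 2) * (b * a / c ^ 2) * (c * b / a ^ 2) = 1 := by field_simp
  rcases exists_integral_of_prod_eq_one p h with h | h | h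
  · exact twistedAbscissae_infinite_of_hyperbola a0 b0 c0 q0 (H _ h.1 h.2)
  · rw [← twistedAbscissae_rotate]
    exact twistedAbscissae_infinite_of_hyperbola b0 c0 a0 q0 (H _ h.1 h.2)
  · rw [← twistedAbscissae_rotate, ← twistedAbscissae_rotate]
    exact twistedAbscissae_infinite_of_hyperbola c0 a0 b0 q0 (H _ h.1 h.2)

theorem twistedAbscissae_one_infinite {a b c q : ℚ} (a0 : a ≠ 0) (b0 : b ≠ 0) (c0 : c ≠ 0)
    (q0 : q ≠ 0) : (twistedAbscissae 1 a b c q).Infinite :=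
  twistedAbscissae_infinite_of_integral 2 a0 b0 c0 q0
    fun _ hα _ => quarticAbscissae_one_infinite hα q0

theorem exists_padicNorm_lt_one_of_one_lt_abs {h : ℚ} (hh : 1 < |h|) :
    ∃ p : ℕ, p.Prime ∧ padicNorm p h < 1 := by
  have hd : (0 : ℚ) < h.den := by exact_mod_cast h.den_pos
  have hne : h.num.natAbs ≠ 1 := by
    intro e
    have h1 : |(h.num : ℚ)| = 1 := by
      rw [← Int.cast_abs, Int.abs_eq_natAbs, e]; simp
    rw [← Rat.num_div_den h, abs_div, h1, abs_of_pos hd, lt_div_iff₀ hd] at hh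
    have : (1 : ℚ) ≤ h.den := by exact_mod_cast h.den_pos
    linarith
  have hp := Nat.minFac_prime hne
  refine ⟨_, hp, ?_⟩
  have : Fact (h.num.natAbs.minFac).Prime := ⟨hp⟩
  set p := h.num.natAbs.minFac with hpdef
  have hdvd : p ∣ h.num.natAbs := Nat.minFac_dvd _
  have hden : ¬ p ∣ h.den := fun hc =>
    hp.one_lt.ne' (Nat.dvd_one.1 (h.reduced ▸ Nat.dvd_gcd hdvd hc))
  have n1 : padicNorm p h.num < 1 :=
    (padicNorm.int_lt_one_iff _).2 (Int.natCast_dvd.2 hdvd)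
  have n2 : padicNorm p h.den = 1 := (padicNorm.nat_eq_one_iff _).2 hden
  rw [← Rat.num_div_den h, padicNorm.div, n2, div_one]
  exact n1

/-- Maximality of `|a + b - c|` gives `|c| ≤ |a + b - c|`. If strict, `h = (a + b - c)/c` has a
prime in its numerator, and the line applies; equality forces `a = b = c`, where the hyperbola has
`α = 1` and a singular cubic. -/
theorem twistedAbscissae_neg_one_infinite_of_abs_le {a b c q : ℚ} (a0 : a ≠ 0) (b0 : b ≠ 0)
    (c0 : c ≠ 0) (q0 : q ≠ 0) (hq : ∀ p : ℕ, p.Prime → padicNorm p q ≤ 1)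
    (h₁ : |b + c - a| ≤ |a + b - c|) (h₂ : |c + a - b| ≤ |a + b - c|) :
    (twistedAbscissae (-1) a b c q).Infinite := by
  have hcD : |c| ≤ |a + b - c| := by
    have := abs_add_le (b + c - a) (c + a - b)
    rw [show b + c - a + (c + a - b) = 2 * c by ring, abs_mul, abs_two] at this
    linarith
  rcases hcD.eq_or_lt with h | h
  · have hab : a = b := by
      rw [← h] at h₁ h₂
      have h₁' := abs_le.1 h₁
      have h₂' := abs_le.1 h₂
      rcases abs_cases c with hc | hc <;> rw [hc.1] at h₁' h₂' <;> linarith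
    subst hab
    have hca : c = a := by
      rcases abs_eq_abs.1 h with h | h
      · linarith
      · exact absurd (by linarith) a0
    subst hca
    refine twistedAbscissae_infinite_of_hyperbola a0 a0 a0 q0 ?_
    rw [show c * c / c ^ 2 = 1 by field_simp]
    exact quarticAbscissae_alpha_one_infinite _ _
  · have hD : a + b - c ≠ 0 := by
      intro e; rw [e] at h; simp at h
      exact absurd h (abs_nonneg c).not_gt
    have hs : a + b ≠ 0 := by
      intro e; rw [e] at h; simp at h
    obtain ⟨p, hp, hpn⟩ := exists_padicNorm_lt_one_of_one_lt_abs (h := (a + b - c) / c)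
      (by rw [abs_div]; exact (one_lt_div (abs_pos.2 c0)).2 h)
    have : Fact p.Prime := ⟨hp⟩
    exact twistedAbscissae_infinite_of_line a0 b0 c0 q0 hs hD
      (quarticAbscissae_neg_one_infinite_of_small (hq p hp) hpn q0 (div_ne_zero hD c0))

theorem twistedAbscissae_neg_one_infinite {a b c q : ℚ} (a0 : a ≠ 0) (b0 : b ≠ 0) (c0 : c ≠ 0)
    (q0 : q ≠ 0) : (twistedAbscissae (-1) a b c q).Infinite := by
  by_cases hq : ∀ p : ℕ, p.Prime → padicNorm p q ≤ 1
  · rcases le_total |b + c - a| |a + b - c| with h₁ | h₁ <;>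
    rcases le_total |c + a - b| |a + b - c| with h₂ | h₂ <;>
    rcases le_total |c + a - b| |b + c - a| with h₃ | h₃
    all_goals first
      | exact twistedAbscissae_neg_one_infinite_of_abs_le a0 b0 c0 q0 hq (by linarith) (by linarith)
      | rw [← twistedAbscissae_rotate]
        exact twistedAbscissae_neg_one_infinite_of_abs_le b0 c0 a0 q0 hq (by linarith) (by linarith)
      | rw [← twistedAbscissae_rotate, ← twistedAbscissae_rotate]
        exact twistedAbscissae_neg_one_infinite_of_abs_le c0 a0 b0 q0 hq (by linarith) (by linarith)
  · push Not at hq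
    obtain ⟨p, hp, hpq⟩ := hq
    have : Fact p.Prime := ⟨hp⟩
    exact twistedAbscissae_infinite_of_integral p a0 b0 c0 q0 fun α hα hα2 =>
      quarticAbscissae_infinite_of_integral (Or.inr rfl) hpq.le
        (padicNorm_two_le.trans_lt hpq) hα q0 hα2

/-! ### The conic case -/

theorem conic_plus_infinite {b k m e : ℚ} (hk : k ≠ 0) (hm : m - e * b ≠ 0) :
    {x : ℚ | ∃ w : ℚ, w ^ 2 = (x + b) ^ 2 + ((e * x + m) / k) ^ 2}.Infinite := by
  refine infinite_of_infinite_pairs (P := fun x => (x + b) ^ 2 + ((e * x + m) / k) ^ 2) ?_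
  have hfin := quadratic_zeros_finite (A := -k) (B := -2 * e) (C := k) (by simp [hk])
  -- The triple is `l · (2t, 1 - t², 1 + t²)`; the linear relation between its two legs determines
  -- the scale `l`, nonzero as `m ≠ eb`.
  set l : ℚ → ℚ := fun t => (m - e * b) / (-k * t ^ 2 + -2 * e * t + k) with hl
  refine (hfin.infinite_compl.image
    (f := fun t => (l t * (2 * t) - b, l t * (1 + t ^ 2))) ?_).mono ?_
  · intro t ht t' ht' h
    have n : l t ≠ 0 := div_ne_zero hm ht
    have n' : l t' ≠ 0 := div_ne_zero hm ht'
    have el : l t * (-k * t ^ 2 + -2 * e * t + k) = m - e * b := div_mul_cancel₀ _ ht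
    have el' : l t' * (-k * t' ^ 2 + -2 * e * t' + k) = m - e * b := div_mul_cancel₀ _ ht'
    simp only [Prod.mk.injEq] at h
    obtain ⟨h1, h2⟩ := h
    have hV : l t * (1 - t ^ 2) = l t' * (1 - t' ^ 2) :=
      mul_left_cancel₀ hk (by linear_combination el - el' + e * h1)
    have hll : l t = l t' := by linarith
    rw [hll] at h1
    exact mul_left_cancel₀ n' (by linarith)
  · rintro _ ⟨t, ht, rfl⟩
    have el : l t * (-k * t ^ 2 + -2 * e * t + k) = m - e * b := div_mul_cancel₀ _ ht
    have : (e * (l t * (2 * t) - b) + m) / k = l t * (1 - t ^ 2) := by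
      rw [div_eq_iff hk]; linear_combination -el
    simp only [Set.mem_ofPred_eq, this]
    ring

theorem conic_minus_infinite {b k m e : ℚ} (hk : k ≠ 0) (hm : m - e * b ≠ 0) :
    {x : ℚ | ∃ w : ℚ, w ^ 2 = (x + b) ^ 2 - ((e * x + m) / k) ^ 2}.Infinite := by
  refine infinite_of_infinite_pairs (P := fun x => (x + b) ^ 2 - ((e * x + m) / k) ^ 2) ?_
  have hfin := quadratic_zeros_finite (A := -e) (B := 2 * k) (C := -e) (by simp [hk])
  -- Here `x + b` is the hypotenuse `l(1 + t²)` and `(ex + m)/k` the leg `2lt`.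
  set l : ℚ → ℚ := fun t => (m - e * b) / (-e * t ^ 2 + 2 * k * t + -e) with hl
  refine (hfin.infinite_compl.image
    (f := fun t => (l t * (1 + t ^ 2) - b, l t * (1 - t ^ 2))) ?_).mono ?_
  · intro t ht t' ht' h
    have n' : l t' ≠ 0 := div_ne_zero hm ht'
    have el : l t * (-e * t ^ 2 + 2 * k * t + -e) = m - e * b := div_mul_cancel₀ _ ht
    have el' : l t' * (-e * t' ^ 2 + 2 * k * t' + -e) = m - e * b := div_mul_cancel₀ _ ht'
    simp only [Prod.mk.injEq] at h
    obtain ⟨h1, h2⟩ := h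
    have hll : l t = l t' := by linarith
    have hV : l t * t = l t' * t' :=
      mul_left_cancel₀ hk (by linear_combination (el - el' + e * h1) / 2)
    rw [hll] at hV
    exact mul_left_cancel₀ n' hV
  · rintro _ ⟨t, ht, rfl⟩
    have el : l t * (-e * t ^ 2 + 2 * k * t + -e) = m - e * b := div_mul_cancel₀ _ ht
    have : (e * (l t * (1 + t ^ 2) - b) + m) / k = l t * (2 * t) := by
      rw [div_eq_iff hk]; linear_combination -el
    simp only [Set.mem_ofPred_eq, this]
    ring

/-- Along `x y = c d`, the equation `z² = f(x)² + ε g(y)²` reduces to a conic. -/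
theorem exists_solution_infinite_of_conic {a b c d e : ℤ} {ε : ℚ} (ha : a ≠ 0)
    (hc : c ≠ 0) (hd : d ≠ 0) (he : e ≠ 0) (h : c * d ≠ e * b)
    (H : {x : ℚ | ∃ w : ℚ, w ^ 2 = (x + b) ^ 2 +
      ε * ((e * x + c * d) / (a * c)) ^ 2}.Infinite) :
    {x : ℚ | ∃ y z : ℚ, x ≠ 0 ∧ y ≠ 0 ∧
      z ^ 2 = laurentF a b c x ^ 2 + ε * laurentG a c d e y ^ 2 ∧
      laurentF a b c x * laurentG a c d e y ≠ 0 ∧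
      laurentF a b c x ^ 2 ≠ laurentG a c d e y ^ 2}.Infinite := by
  have a0 : (a : ℚ) ≠ 0 := by exact_mod_cast ha
  have c0 : (c : ℚ) ≠ 0 := by exact_mod_cast hc
  have d0 : (d : ℚ) ≠ 0 := by exact_mod_cast hd
  have e0 : (e : ℚ) ≠ 0 := by exact_mod_cast he
  have h0 : (c * d - e * b : ℚ) ≠ 0 := sub_ne_zero.2 (by exact_mod_cast h)
  have ac0 : (a * c : ℚ) ≠ 0 := mul_ne_zero a0 c0
  have hlin (s : ℚ) (hs : s ≠ 0) :
      (a * c + s * e : ℚ) ≠ 0 ∨ (a * c * b + s * (c * d) : ℚ) ≠ 0 := by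
    by_contra! hcon
    refine h0 (mul_left_cancel₀ hs ?_)
    linear_combination hcon.2 - b * hcon.1
  have hfin : ({x : ℚ | 1 * x + 0 = 0} ∪ {x : ℚ | 1 * x + a = 0} ∪ {x : ℚ | 1 * x + b = 0} ∪
      {x : ℚ | 1 * x + c = 0} ∪ {x : ℚ | e * x + c * d = 0} ∪
      {x : ℚ | (a * c + 1 * e) * x + (a * c * b + 1 * (c * d)) = 0} ∪
      {x : ℚ | (a * c + -1 * e) * x + (a * c * b + -1 * (c * d)) = 0}).Finite :=
    ((((((linear_zeros_finite (by simp)).union (linear_zeros_finite (by simp))).union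
      (linear_zeros_finite (by simp))).union (linear_zeros_finite (by simp))).union
      (linear_zeros_finite (Or.inl e0))).union
      (linear_zeros_finite (hlin 1 (by norm_num)))).union
      (linear_zeros_finite (hlin (-1) (by norm_num)))
  refine (H.sdiff hfin).mono ?_
  rintro x ⟨⟨w, hw⟩, hx⟩
  simp only [Set.mem_union, Set.mem_ofPred_eq, not_or, one_mul, add_zero] at hx
  obtain ⟨⟨⟨⟨⟨⟨x0, xa⟩, xb⟩, xc⟩, xe⟩, x1⟩, x2⟩ := hx
  set k : ℚ := (x + a) * (x + c) / x with hk
  have k0 : k ≠ 0 := by positivity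
  have eF : laurentF a b c x = k * (x + b) := by
    unfold laurentF; rw [hk]; field_simp
  have eG : laurentG a c d e (c * d / x) = k * ((e * x + c * d) / (a * c)) := by
    unfold laurentG; rw [hk]; field_simp; ring
  refine ⟨c * d / x, k * w, x0, by positivity, ?_, ?_, ?_⟩
  · rw [eF, eG]; linear_combination k ^ 2 * hw
  · rw [eF, eG]; positivity
  · rw [eF, eG]
    intro hE
    have : k ^ 2 * (((a * c + e) * x + (a * c * b + c * d)) *
        ((a * c + -1 * e) * x + (a * c * b + -1 * (c * d)))) = 0 := by
      field_simp at hE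
      linear_combination k ^ 2 * hE
    exact mul_ne_zero (pow_ne_zero 2 k0) (mul_ne_zero x1 x2) this

theorem exists_solution_infinite_of_twisted {a b c d e : ℤ} {ε : ℚ} (ha : a ≠ 0) (hb : b ≠ 0)
    (hc : c ≠ 0) (hd : d ≠ 0) (h : c * d = e * b)
    (H : (twistedAbscissae ε a b c (d / (a * b))).Infinite) :
    {x : ℚ | ∃ y z : ℚ, x ≠ 0 ∧ y ≠ 0 ∧
      z ^ 2 = laurentF a b c x ^ 2 + ε * laurentG a c d e y ^ 2 ∧
      laurentF a b c x * laurentG a c d e y ≠ 0 ∧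
      laurentF a b c x ^ 2 ≠ laurentG a c d e y ^ 2}.Infinite := by
  have a0 : (a : ℚ) ≠ 0 := by exact_mod_cast ha
  have b0 : (b : ℚ) ≠ 0 := by exact_mod_cast hb
  have c0 : (c : ℚ) ≠ 0 := by exact_mod_cast hc
  have d0 : (d : ℚ) ≠ 0 := by exact_mod_cast hd
  have he : (e : ℚ) = c * d / b := by
    rw [eq_div_iff b0]; exact_mod_cast h.symm
  refine H.mono ?_
  rintro x ⟨u, z, x0, u0, h1, h2, h3⟩
  -- With `e = cd/b`, the roots of `laurentG` correspond under `y = cd/u` to those of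
  -- `laurentCubic`.
  have eG : laurentG a c d e (c * d / u) = d / (a * b) * laurentCubic a b c u := by
    unfold laurentG laurentCubic; rw [he]; field_simp; ring
  refine ⟨c * d / u, z, x0, by positivity, ?_, ?_, ?_⟩ <;> rw [eG] <;> assumption

theorem theorem1p4 (a b c d e : ℤ) (ha : a ≠ 0) (hb : b ≠ 0) (hc : c ≠ 0) (hd : d ≠ 0)
    (he : e ≠ 0) :
    (nontrivialSolutionsPlus (laurentF a b c) (laurentG a c d e)).Infinite ∧
      (nontrivialSolutionsMinus (laurentF a b c) (laurentG a c d e)).Infinite := by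
  have a0 : (a : ℚ) ≠ 0 := by exact_mod_cast ha
  have b0 : (b : ℚ) ≠ 0 := by exact_mod_cast hb
  have c0 : (c : ℚ) ≠ 0 := by exact_mod_cast hc
  have d0 : (d : ℚ) ≠ 0 := by exact_mod_cast hd
  have q0 : (d / (a * b) : ℚ) ≠ 0 := by positivity
  have ac0 : (a * c : ℚ) ≠ 0 := mul_ne_zero a0 c0
  constructor
  · refine Set.Infinite.of_image Prod.fst (Set.Infinite.mono ?_ (s := {x : ℚ | ∃ y z : ℚ,
      x ≠ 0 ∧ y ≠ 0 ∧ z ^ 2 = laurentF a b c x ^ 2 + 1 * laurentG a c d e y ^ 2 ∧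
      laurentF a b c x * laurentG a c d e y ≠ 0 ∧
      laurentF a b c x ^ 2 ≠ laurentG a c d e y ^ 2}) ?_)
    · rintro x ⟨y, z, x0, y0, h1, h2, h3⟩
      exact ⟨(x, y, z), ⟨x0, y0, by simpa using h1, h2, h3⟩, rfl⟩
    · by_cases h : c * d = e * b
      · exact exists_solution_infinite_of_twisted ha hb hc hd h
          (twistedAbscissae_one_infinite a0 b0 c0 q0)
      · refine exists_solution_infinite_of_conic ha hc hd he h ?_
        simpa using conic_plus_infinite (b := b) (m := c * d) (e := e) ac0
          (sub_ne_zero.2 (by exact_mod_cast h))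
  · refine Set.Infinite.of_image Prod.fst (Set.Infinite.mono ?_ (s := {x : ℚ | ∃ y z : ℚ,
      x ≠ 0 ∧ y ≠ 0 ∧ z ^ 2 = laurentF a b c x ^ 2 + -1 * laurentG a c d e y ^ 2 ∧
      laurentF a b c x * laurentG a c d e y ≠ 0 ∧
      laurentF a b c x ^ 2 ≠ laurentG a c d e y ^ 2}) ?_)
    · rintro x ⟨y, z, x0, y0, h1, h2, h3⟩
      exact ⟨(x, y, z), ⟨x0, y0, by simpa [sub_eq_add_neg] using h1, h2, h3⟩, rfl⟩
    · by_cases h : c * d = e * b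
      · exact exists_solution_infinite_of_twisted ha hb hc hd h
          (twistedAbscissae_neg_one_infinite a0 b0 c0 q0)
      · refine exists_solution_infinite_of_conic ha hc hd he h ?_
        simpa [sub_eq_add_neg] using conic_minus_infinite (b := b) (m := c * d) (e := e) ac0
          (sub_ne_zero.2 (by exact_mod_cast h))
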